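/- Let $R$ be a commutative Noetherian ring with no nonzero nilpotent elements. Consider any additive closed symmetric monoidal structure on the category of $R$-modules, that is, a symmetric monoidal structure (not necessarily the usual tensor product $\otimes_R$) whose product $-\wedge-$ is additive in each variable and for which every functor $M\wedge -$ has a right adjoint, and let $K$ be its unit object. Then there are ideals $\mathfrak{b}\subseteq\mathfrak{a}$ of $R$ such that $\mathfrak{b}$ is a radical ideal, $(\mathfrak{b}:\mathfrak{a})=\mathfrak{b}$, where $(\mathfrak{b}:\mathfrak{a})=\{x\in R : x\mathfrak{a}\subseteq\mathfrak{b}\}$, and $$K\cong \mathfrak{a}/\mathfrak{b}$$ as $R$-modules. -/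

import Mathlib

open CategoryTheory MonoidalCategory

universe v u

/-- An additive closed symmetric monoidal structure on a preadditive category `C`:
a monoidal structure together with a symmetry, such that every functor `X ⊗ -` has a right
adjoint, and such that the product is additive in each of its two variables. The monoidal
structure is a field, so that any monoidal structure on `C` is allowed, independently of an
instance that `C` may already carry. -/
structure AdditiveClosedSymmetricMonoidalStructure
    (C : Type u) [Category.{v} C] [Preadditive C] where
  [monoidal : MonoidalCategory C]
  [symmetric : SymmetricCategory C]
  [closed : MonoidalClosed C]
  [additive : MonoidalPreadditive C]

/-- The unit object of an additive closed symmetric monoidal structure. -/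
def AdditiveClosedSymmetricMonoidalStructure.unit
    {C : Type u} [Category.{v} C] [Preadditive C]
    (S : AdditiveClosedSymmetricMonoidalStructure C) : C :=
  letI := S.monoidal
  𝟙_ C

/-! An endomorphism of the unit K acts on every module through the left unitor. Naturality along
maps R → M makes this action a scalar, and on K it is the given endomorphism, so End K consists of
scalars. Squaring this action shows that ann K is radical. Closedness makes R ≅ K ∧ R the sum of the
images of R ∧ R under maps R → K; finitely many reach 1, and these generate K.

What remains is module theory over R/𝔟, where 𝔟 = ann K. Scalar endomorphisms force every associated
prime to be minimal, and maps to R/p for minimal p then assemble into an embedding K → R/𝔟. Its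
image is 𝔞/𝔟, and (𝔟 : 𝔞) is the annihilator of that image. -/

/-- A finitely generated module supported at a prime `p` has a nonzero map to `R ⧸ p`. -/
theorem Module.exists_linearMap_quotient_ne_zero {R M : Type*} [CommRing R] [AddCommGroup M]
    [Module R M] [Module.Finite R M] (p : Ideal R) [p.IsPrime]
    (hp : Module.annihilator R M ≤ p) : ∃ g : M →ₗ[R] R ⧸ p, g ≠ 0 := by
  have hsupp : (⟨p, inferInstance⟩ : PrimeSpectrum R) ∈ Module.support R M := by
    rw [Module.support_eq_zeroLocus]
    exact hp
  rw [Module.mem_support_iff_nontrivial_residueField_tensorProduct] at hsupp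
  change Nontrivial (TensorProduct R p.ResidueField M) at hsupp
  obtain ⟨z, hz⟩ := exists_ne (0 : TensorProduct R p.ResidueField M)
  obtain ⟨φ, hφ⟩ : ∃ φ : Module.Dual p.ResidueField (TensorProduct R p.ResidueField M),
      φ z ≠ 0 := by
    by_contra! h
    exact hz ((Module.forall_dual_apply_eq_zero_iff _ z).mp h)
  let ψ : M →ₗ[R] p.ResidueField :=
    φ.restrictScalars R ∘ₗ TensorProduct.mk R p.ResidueField M 1
  obtain ⟨m, hm⟩ : ∃ m, ψ m ≠ 0 := by
    by_contra! h
    refine hφ (TensorProduct.induction_on z (map_zero φ) (fun a m ↦ ?_) fun x y hx hy ↦ ?_)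
    · have : a ⊗ₜ[R] m = a • ((1 : p.ResidueField) ⊗ₜ[R] m) := by
        rw [TensorProduct.smul_tmul', smul_eq_mul, mul_one]
      rw [this, map_smul]
      exact (congrArg (a • ·) (h m)).trans (smul_zero a)
    · rw [map_add, hx, hy, add_zero]
  classical
  -- The values of ψ on finitely many generators have a common denominator d; multiplying by a lift
  -- r of d moves ψ into R/p.
  obtain ⟨s, hs⟩ := Module.Finite.fg_top (R := R) (M := M)
  obtain ⟨d, hd⟩ := IsLocalization.exist_integer_multiples_of_finset
    (nonZeroDivisors (R ⧸ p)) (s.image ψ)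
  obtain ⟨r, hr⟩ := Ideal.Quotient.mk_surjective (d : R ⧸ p)
  let ι : (R ⧸ p) →ₗ[R] p.ResidueField :=
    (Algebra.linearMap (R ⧸ p) p.ResidueField).restrictScalars R
  have hι : Function.Injective ι := p.injective_algebraMap_quotient_residueField
  have hrange : ∀ x, (r • ψ) x ∈ LinearMap.range ι := by
    intro x
    have hx : x ∈ Submodule.span R (s : Set M) := hs ▸ Submodule.mem_top
    induction hx using Submodule.span_induction with
    | mem x hx =>
      obtain ⟨y, hy⟩ := hd (ψ x) (Finset.mem_image_of_mem ψ hx)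
      refine ⟨y, hy.trans ?_⟩
      change (d : R ⧸ p) • ψ x = r • ψ x
      rw [← hr, ← algebraMap_smul (R ⧸ p) r (ψ x)]
      rfl
    | zero => rw [map_zero]; exact zero_mem _
    | add x y _ _ hx hy => rw [map_add]; exact add_mem hx hy
    | smul a x _ hx => rw [map_smul]; exact Submodule.smul_mem _ a hx
  refine ⟨(LinearEquiv.ofInjective ι hι).symm ∘ₗ (r • ψ).codRestrict _ hrange, fun h ↦ ?_⟩
  have h0 := LinearMap.congr_fun h m
  have h1 : (r • ψ).codRestrict _ hrange m = 0 := by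
    simpa using h0
  have h2 : r • ψ m = 0 := congrArg Subtype.val h1
  rw [← algebraMap_smul (R ⧸ p) r (ψ m), Algebra.smul_def] at h2
  refine (mul_ne_zero ?_ hm) h2
  change algebraMap _ _ (Ideal.Quotient.mk p r) ≠ 0
  rw [hr]
  exact map_ne_zero_of_mem_nonZeroDivisors _ p.injective_algebraMap_quotient_residueField d.2

/-- The `R`-linear map `R ⧸ p → M` sending `1` to an element `x` killed by `p`. -/
def Ideal.quotientToSpanSingleton {R M : Type*} [CommRing R] [AddCommGroup M] [Module R M]
    (p : Ideal R) (x : M) (hx : ∀ a ∈ p, a • x = 0) : (R ⧸ p) →ₗ[R] M :=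
  Submodule.liftQ p (LinearMap.toSpanSingleton R M x) fun a ha ↦ by simpa using hx a ha

@[simp]
theorem Ideal.quotientToSpanSingleton_mk {R M : Type*} [CommRing R] [AddCommGroup M] [Module R M]
    (p : Ideal R) (x : M) (hx : ∀ a ∈ p, a • x = 0) (r : R) :
    p.quotientToSpanSingleton x hx (Ideal.Quotient.mk p r) = r • x :=
  rfl

/-- In a reduced ring, an element of all minimal primes is zero. -/
theorem eq_zero_of_forall_mem_minimalPrimes {R : Type*} [CommRing R] [IsReduced R] {a : R}
    (ha : ∀ q ∈ minimalPrimes R, a ∈ q) : a = 0 := by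
  have h : a ∈ sInf (minimalPrimes R) := Submodule.mem_sInf.mpr ha
  rw [minimalPrimes, Ideal.sInf_minimalPrimes] at h
  obtain ⟨n, hn⟩ := h
  exact IsReduced.eq_zero a ⟨n, hn⟩

/-! ### Embedding a module with scalar endomorphisms -/

section ScalarEndomorphisms

variable {R M : Type*} [CommRing R] [IsNoetherianRing R] [IsReduced R] [AddCommGroup M]
  [Module R M] [Module.Finite R M]

/-- Over a reduced Noetherian ring, if `M` is finitely generated and faithful and all its
endomorphisms are scalars, then the annihilator of each nonzero element lies in a minimal prime. -/
theorem Module.exists_minimalPrimes_of_endomorphisms_scalar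
    (hfaith : Module.annihilator R M = ⊥)
    (hend : ∀ f : M →ₗ[R] M, ∃ r : R, ∀ m, f m = r • m) {x : M} (hx : x ≠ 0) :
    ∃ p ∈ minimalPrimes R, ∀ a : R, a • x = 0 → a ∈ p := by
  obtain ⟨p, hp, hxp⟩ := exists_le_isAssociatedPrime_of_isNoetherianRing R x hx
  refine ⟨p, ?_, fun a ha ↦ hxp (Submodule.mem_colon_singleton.mpr ha)⟩
  obtain ⟨hprime, y, hy⟩ := isAssociatedPrime_iff.mp hp
  have hy' (a : R) : a ∈ p ↔ a • y = 0 := by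
    rw [hy, Submodule.mem_colon_singleton, Submodule.mem_bot]
  obtain ⟨g, hg⟩ := Module.exists_linearMap_quotient_ne_zero (M := M) p (hfaith ▸ bot_le)
  -- M → R/p ≅ Ry ⊆ M is a nonzero scalar s killed by p, so p lies in any minimal prime avoiding s.
  obtain ⟨s, hs⟩ := hend (p.quotientToSpanSingleton y (fun a ha ↦ (hy' a).mp ha) ∘ₗ g)
  have hs0 : s ≠ 0 := by
    rintro rfl
    refine hg (LinearMap.ext fun m ↦ ?_)
    obtain ⟨c, hc⟩ := Ideal.Quotient.mk_surjective (g m)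
    have := hs m
    rw [LinearMap.comp_apply, ← hc, Ideal.quotientToSpanSingleton_mk, zero_smul, ← hy'] at this
    rw [← hc, LinearMap.zero_apply, Ideal.Quotient.eq_zero_iff_mem]
    exact this
  have hps (a : R) (ha : a ∈ p) : a * s = 0 := by
    rw [← Ideal.mem_bot, ← hfaith, Module.mem_annihilator]
    intro m
    rw [mul_smul, ← hs, ← map_smul, LinearMap.comp_apply]
    have : g (a • m) = 0 := by
      obtain ⟨c, hc⟩ := Ideal.Quotient.mk_surjective (g m)
      rw [map_smul, ← hc, Algebra.smul_def]
      change Ideal.Quotient.mk p a * _ = 0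
      rw [Ideal.Quotient.eq_zero_iff_mem.mpr ha, zero_mul]
    rw [this, map_zero]
  obtain ⟨q, hq, hsq⟩ : ∃ q ∈ minimalPrimes R, s ∉ q := by
    by_contra! h
    exact hs0 (eq_zero_of_forall_mem_minimalPrimes h)
  have hqprime : q.IsPrime := hq.1.1
  have hpq : p ≤ q := fun a ha ↦
    (hqprime.mem_or_mem (hps a ha ▸ q.zero_mem : a * s ∈ q)).resolve_right hsq
  exact (hpq.antisymm (hq.2 ⟨hprime, bot_le⟩ hpq)) ▸ hq

/-- In a Noetherian ring, a minimal prime is complemented by an element of all the other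
minimal primes. -/
theorem exists_notMem_minimalPrime_forall_mem {R : Type*} [CommRing R] [IsNoetherianRing R]
    {p : Ideal R} (hp : p ∈ minimalPrimes R) :
    ∃ t ∉ p, ∀ q ∈ minimalPrimes R, q ≠ p → t ∈ q := by
  classical
  have hprime : p.IsPrime := hp.1.1
  by_contra! h
  have hle : ((minimalPrimes.finite_of_isNoetherianRing R).toFinset.erase p).inf id ≤ p := by
    intro t ht
    by_contra htp
    obtain ⟨q, hq, hqp, htq⟩ := h t htp
    exact htq ((Finset.inf_le (f := id) (by simp [hq, hqp]) :
      (Finset.inf _ id : Ideal R) ≤ q) ht)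
  obtain ⟨q, hq, hqp⟩ := hprime.inf_le'.mp hle
  simp only [Finset.mem_erase, Set.Finite.mem_toFinset] at hq
  exact hq.1 (hqp.antisymm (hp.2 hq.2.1 hqp))

/-- Over a reduced Noetherian ring, a finitely generated faithful module all of whose
endomorphisms are scalars embeds into the ring. -/
theorem Module.exists_injective_of_endomorphisms_scalar
    (hfaith : Module.annihilator R M = ⊥)
    (hend : ∀ f : M →ₗ[R] M, ∃ r : R, ∀ m, f m = r • m) :
    ∃ f : M →ₗ[R] R, Function.Injective f := by
  classical
  have hfin := minimalPrimes.finite_of_isNoetherianRing R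
  have : Fintype (minimalPrimes R) := hfin.fintype
  have hprime (p : minimalPrimes R) : (p : Ideal R).IsPrime := p.2.1.1
  choose t htp htq using fun p : minimalPrimes R ↦ exists_notMem_minimalPrime_forall_mem p.2
  choose g hg using fun p : minimalPrimes R ↦
    Module.exists_linearMap_quotient_ne_zero (M := M) (p : Ideal R) (hfaith ▸ bot_le)
  have hpt (p : minimalPrimes R) {a : R} (ha : a ∈ (p : Ideal R)) : a * t p = 0 := by
    refine eq_zero_of_forall_mem_minimalPrimes fun q hq ↦ ?_
    by_cases h : q = p
    · exact q.mul_mem_right _ (h ▸ ha)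
    · exact q.mul_mem_left _ (htq p q hq h)
  have htt (p q : minimalPrimes R) (h : p ≠ q) : t q * t p = 0 :=
    hpt p (htq q p p.2 fun e ↦ h (Subtype.ext e))
  let F (p : minimalPrimes R) : M →ₗ[R] R :=
    (p : Ideal R).quotientToSpanSingleton (t p) (fun a ha ↦ hpt p ha) ∘ₗ g p
  refine ⟨∑ p, F p, (injective_iff_map_eq_zero _).mpr fun k hk ↦ ?_⟩
  -- Multiplying by `t q` kills every summand except `F q`.
  have hgk (q : minimalPrimes R) : g q k = 0 := by
    obtain ⟨c, hc⟩ := Ideal.Quotient.mk_surjective (g q k)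
    have hF (p : minimalPrimes R) : ∃ c, F p k = c * t p ∧ Ideal.Quotient.mk _ c = g p k := by
      obtain ⟨c, hc⟩ := Ideal.Quotient.mk_surjective (g p k)
      exact ⟨c, by rw [LinearMap.comp_apply, ← hc]; rfl, hc⟩
    choose c hFc hc using hF
    rw [LinearMap.sum_apply] at hk
    have h1 : t q * ∑ p, F p k = t q * F q k := by
      rw [Finset.mul_sum]
      refine Finset.sum_eq_single q (fun p _ hpq ↦ ?_) (by simp)
      rw [hFc, mul_left_comm, htt p q hpq, mul_zero]
    rw [hk, mul_zero, hFc] at h1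
    rw [← hc, Ideal.Quotient.eq_zero_iff_mem]
    have h2 : t q * (c q * t q) ∈ (q : Ideal R) := h1 ▸ zero_mem _
    have h3 := ((hprime q).mem_or_mem h2).resolve_left (htp q)
    exact ((hprime q).mem_or_mem h3).resolve_right (htp q)
  have htk (q : minimalPrimes R) : t q • k = 0 := by
    by_contra hx
    have hqx (a : R) (ha : a ∈ (q : Ideal R)) : a • t q • k = 0 := by
      rw [smul_smul, hpt q ha, zero_smul]
    obtain ⟨q', hq', hann⟩ := Module.exists_minimalPrimes_of_endomorphisms_scalar hfaith hend hx
    have hqq' : (q : Ideal R) ≤ q' := fun a ha ↦ hann a (hqx a ha)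
    obtain rfl : q' = q := (hq'.2 ⟨hprime q, bot_le⟩ hqq').antisymm hqq'
    -- Since `g q` kills k, it kills the image of this endomorphism. This puts s in q, hence `t q *
    -- s = 0`.
    obtain ⟨s, hs⟩ := hend ((q : Ideal R).quotientToSpanSingleton (t q • k) hqx ∘ₗ g q)
    obtain ⟨m, hm⟩ : ∃ m, g q m ≠ 0 := by
      by_contra! h
      exact hg q (LinearMap.ext h)
    obtain ⟨c, hc⟩ := Ideal.Quotient.mk_surjective (g q m)
    have h1 : c • t q • k = s • m := by
      rw [← hs, LinearMap.comp_apply, ← hc, Ideal.quotientToSpanSingleton_mk]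
    have hcq : c ∉ (q : Ideal R) := fun h ↦
      hm (hc ▸ Ideal.Quotient.eq_zero_iff_mem.mpr h)
    have hsq : s ∈ (q : Ideal R) := by
      have h2 := congrArg (g q) h1
      rw [map_smul, map_smul, hgk, smul_zero, smul_zero, map_smul, ← hc, eq_comm] at h2
      have h3 : Ideal.Quotient.mk (q : Ideal R) (s * c) = 0 := h2
      rw [Ideal.Quotient.eq_zero_iff_mem] at h3
      exact ((hprime q).mem_or_mem h3).resolve_right hcq
    have h4 : (t q * c) • t q • k = 0 := by
      rw [mul_smul, h1, smul_smul, mul_comm, hpt q hsq, zero_smul]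
    exact ((hprime q).mem_or_mem (hann _ h4)).elim (htp q) hcq
  by_contra hk0
  obtain ⟨p, hp, hann⟩ := Module.exists_minimalPrimes_of_endomorphisms_scalar hfaith hend hk0
  exact htp ⟨p, hp⟩ (hann _ (htk ⟨p, hp⟩))

end ScalarEndomorphisms

/-- Over a Noetherian ring, a finitely generated module whose annihilator `𝔟` is radical and all of
whose endomorphisms are scalars is isomorphic to `𝔞 / 𝔟` for an ideal `𝔞`, and `(𝔟 : 𝔞) = 𝔟`. -/
theorem Module.exists_ideal_quotient_equiv_of_endomorphisms_scalar {R M : Type*} [CommRing R]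
    [IsNoetherianRing R] [AddCommGroup M] [Module R M] [Module.Finite R M] {𝔟 : Ideal R}
    (h𝔟 : Module.annihilator R M = 𝔟) (hrad : 𝔟.IsRadical)
    (hend : ∀ f : M →ₗ[R] M, ∃ r : R, ∀ m, f m = r • m) :
    ∃ 𝔞 : Ideal R, 𝔟 ≤ 𝔞 ∧ 𝔟.colon (𝔞 : Set R) = 𝔟 ∧
      Nonempty (M ≃ₗ[R] (𝔞 ⧸ 𝔟.submoduleOf 𝔞)) := by
  have htors : Module.IsTorsionBySet R M 𝔟 := fun m a ↦
    Module.mem_annihilator.mp (h𝔟 ▸ a.2) m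
  let _ : Module (R ⧸ 𝔟) M := htors.module
  have _ : IsScalarTower R (R ⧸ 𝔟) M := htors.isScalarTower
  have _ : Module.Finite (R ⧸ 𝔟) M := Module.Finite.of_restrictScalars_finite R _ _
  have _ : IsReduced (R ⧸ 𝔟) := (Ideal.isRadical_iff_quotient_reduced 𝔟).mp hrad
  have hsmul (r : R) (m : M) : Ideal.Quotient.mk 𝔟 r • m = r • m :=
    algebraMap_smul (R ⧸ 𝔟) r m
  obtain ⟨f, hf⟩ := Module.exists_injective_of_endomorphisms_scalar (R := R ⧸ 𝔟) (M := M)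
    (by
      refine eq_bot_iff.mpr fun x hx ↦ ?_
      obtain ⟨r, rfl⟩ := Ideal.Quotient.mk_surjective x
      rw [Ideal.mem_bot, Ideal.Quotient.eq_zero_iff_mem, ← h𝔟, Module.mem_annihilator]
      intro m
      rw [← hsmul]
      exact Module.mem_annihilator.mp hx m)
    (fun f ↦ by
      obtain ⟨r, hr⟩ := hend (f.restrictScalars R)
      exact ⟨Ideal.Quotient.mk 𝔟 r, fun m ↦ by rw [hsmul, ← hr]; rfl⟩)
  let F : M →ₗ[R] R ⧸ 𝔟 := f.restrictScalars R
  let 𝔞 : Ideal R := (LinearMap.range F).comap (Submodule.mkQ 𝔟)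
  have hle : 𝔟 ≤ 𝔞 := fun x hx ↦ by
    refine ⟨0, ?_⟩
    rw [map_zero]
    exact ((Submodule.Quotient.mk_eq_zero 𝔟).mpr hx).symm
  refine ⟨𝔞, hle, le_antisymm (fun x hx ↦ ?_) Ideal.le_colon, ⟨?_⟩⟩
  · rw [← h𝔟, Module.mem_annihilator]
    intro m
    obtain ⟨s, hs⟩ := Submodule.mkQ_surjective 𝔟 (F m)
    have hxs : x • s ∈ 𝔟 := Submodule.mem_colon.mp hx s ⟨m, hs.symm⟩
    apply hf
    change F (x • m) = F 0
    rw [map_smul, map_zero, ← hs, ← map_smul]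
    exact (Submodule.Quotient.mk_eq_zero 𝔟).mpr hxs
  · let h : 𝔞 →ₗ[R] R ⧸ 𝔟 := Submodule.mkQ 𝔟 ∘ₗ Submodule.subtype 𝔞
    have hker : LinearMap.ker h = 𝔟.submoduleOf 𝔞 := by
      rw [LinearMap.ker_comp, Submodule.ker_mkQ]
      rfl
    have hrange : LinearMap.range h = LinearMap.range F := by
      rw [LinearMap.range_comp, Submodule.range_subtype,
        Submodule.map_comap_eq_of_surjective (Submodule.mkQ_surjective 𝔟)]
    exact LinearEquiv.ofInjective F hf ≪≫ₗ LinearEquiv.ofEq _ _ hrange.symm ≪≫ₗ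
      h.quotKerEquivRange.symm ≪≫ₗ Submodule.quotEquivOfEq _ _ hker

/-! ### The unit of a monoidal structure on modules -/

section MonoidalModuleCat

-- With the usual tensor product disabled, the monoidal notation refers to the arbitrary structure.
attribute [-instance] ModuleCat.MonoidalCategory.instMonoidalCategoryStruct
  ModuleCat.monoidalCategory

variable {R : Type u} [CommRing R] [MonoidalCategory (ModuleCat.{u} R)]

/-- A morphism out of `Q ⊗ M` is determined by its restrictions along the maps `R ⟶ M`. -/
theorem ModuleCat.hom_ext_whiskerLeft [MonoidalClosed (ModuleCat.{u} R)] {Q M N : ModuleCat.{u} R}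
    {f g : Q ⊗ M ⟶ N}
    (h : ∀ e : ModuleCat.of R R ⟶ M, (Q ◁ e) ≫ f = (Q ◁ e) ≫ g) : f = g := by
  -- After currying, two maps out of M are compared on elements, that is, on maps R → M.
  apply MonoidalClosed.curry_injective
  ext m
  have := congrArg MonoidalClosed.curry (h (ModuleCat.ofHom (LinearMap.toSpanSingleton R M m)))
  rw [MonoidalClosed.curry_natural_left, MonoidalClosed.curry_natural_left] at this
  simpa using ConcreteCategory.congr_hom this (1 : R)

/-- A morphism out of `M ⊗ Q` is determined by its restrictions along the maps `R ⟶ M`. -/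
theorem ModuleCat.hom_ext_whiskerRight [SymmetricCategory (ModuleCat.{u} R)]
    [MonoidalClosed (ModuleCat.{u} R)] {Q M N : ModuleCat.{u} R} {f g : M ⊗ Q ⟶ N}
    (h : ∀ e : ModuleCat.of R R ⟶ M, (e ▷ Q) ≫ f = (e ▷ Q) ≫ g) : f = g := by
  rw [← cancel_epi (β_ Q M).hom]
  refine ModuleCat.hom_ext_whiskerLeft fun e ↦ ?_
  rw [BraidedCategory.braiding_naturality_right_assoc, h,
    BraidedCategory.braiding_naturality_right_assoc]

/-- The unit of an additive closed symmetric monoidal structure on modules is finitely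
generated. -/
theorem ModuleCat.finite_tensorUnit [SymmetricCategory (ModuleCat.{u} R)]
    [MonoidalClosed (ModuleCat.{u} R)] [MonoidalPreadditive (ModuleCat.{u} R)] :
    Module.Finite R (𝟙_ (ModuleCat.{u} R)) := by
  let A := ModuleCat.of R R
  let K := 𝟙_ (ModuleCat.{u} R)
  let T (e : A ⟶ K) : A ⊗ A ⟶ A := (e ▷ A) ≫ (λ_ A).hom
  let I (e : A ⟶ K) : Submodule R R := LinearMap.range (T e).hom
  have htop : ⨆ e, I e = ⊤ := by
    let q : A ⟶ ModuleCat.of R (R ⧸ (⨆ e, I e)) := ModuleCat.ofHom (Submodule.mkQ _)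
    have hq : (λ_ A).hom ≫ q = 0 := by
      refine ModuleCat.hom_ext_whiskerRight fun e ↦ ?_
      rw [Limits.comp_zero]
      ext x
      refine (Submodule.Quotient.mk_eq_zero _).mpr ?_
      exact Submodule.mem_iSup_of_mem e ⟨x, rfl⟩
    have hq0 : q = 0 := by
      rw [← cancel_epi (λ_ A).hom, hq, Limits.comp_zero]
    refine eq_top_iff.mpr fun x _ ↦ ?_
    exact (Submodule.Quotient.mk_eq_zero _).mp (ConcreteCategory.congr_hom hq0 x)
  obtain ⟨s, hs⟩ := Submodule.mem_iSup_iff_exists_finset.mp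
    (htop ▸ Submodule.mem_top : (1 : R) ∈ ⨆ e, I e)
  let P : Submodule R K := Submodule.span R ((fun e : A ⟶ K ↦ e.hom (1 : R)) '' s)
  let π : K ⟶ ModuleCat.of R (K ⧸ P) := ModuleCat.ofHom P.mkQ
  have heπ (e : A ⟶ K) (he : e ∈ s) : e ≫ π = 0 := by
    ext
    exact (Submodule.Quotient.mk_eq_zero _).mpr (Submodule.subset_span ⟨e, he, rfl⟩)
  -- The kernel of R ≅ K ∧ R → (K/P) ∧ R contains the images that sum to an ideal containing 1.
  have hπA : π ▷ A = 0 := by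
    have hle : ⨆ e ∈ s, I e ≤ LinearMap.ker ((λ_ A).inv ≫ π ▷ A).hom := by
      refine iSup₂_le fun e he ↦ ?_
      rintro _ ⟨x, rfl⟩
      have h0 : T e ≫ (λ_ A).inv ≫ π ▷ A = 0 := by
        simp only [T, Category.assoc, Iso.hom_inv_id_assoc]
        rw [← comp_whiskerRight, heπ e he, MonoidalPreadditive.zero_whiskerRight]
      exact ConcreteCategory.congr_hom h0 x
    have h1 : (λ_ A).inv ≫ π ▷ A = 0 := by
      ext
      exact hle hs
    rw [← cancel_epi (λ_ A).inv, h1, Limits.comp_zero]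
  -- Testing on maps R → K, the interchange law reduces this to π ∧ R = 0.
  have hπK : π ▷ K = 0 := by
    refine ModuleCat.hom_ext_whiskerLeft fun e ↦ ?_
    rw [whisker_exchange, hπA, Limits.zero_comp, Limits.comp_zero]
  have hπ : π = 0 := by
    rw [← cancel_epi (ρ_ K).hom, ← rightUnitor_naturality, hπK, Limits.zero_comp, Limits.comp_zero]
  have hP : P = ⊤ := eq_top_iff.mpr fun x _ ↦
    (Submodule.Quotient.mk_eq_zero _).mp (ConcreteCategory.congr_hom hπ x)
  classical
  exact ⟨⟨s.image fun e : A ⟶ K ↦ e.hom (1 : R), by rw [Finset.coe_image]; exact hP⟩⟩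

/-- An endomorphism of the unit of a monoidal structure on modules acts on all modules through a
scalar. -/
theorem ModuleCat.exists_whiskerRight_eq_smul (f : 𝟙_ (ModuleCat.{u} R) ⟶ 𝟙_ (ModuleCat.{u} R)) :
    ∃ r : R, ∀ (M : ModuleCat.{u} R) (m : M), ((λ_ M).inv ≫ f ▷ M ≫ (λ_ M).hom) m = r • m := by
  let A := ModuleCat.of R R
  refine ⟨((λ_ A).inv ≫ f ▷ A ≫ (λ_ A).hom) (1 : R), fun M m ↦ ?_⟩
  let e : A ⟶ M := ModuleCat.ofHom (LinearMap.toSpanSingleton R M m)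
  have h : e ≫ (λ_ M).inv ≫ f ▷ M ≫ (λ_ M).hom = ((λ_ A).inv ≫ f ▷ A ≫ (λ_ A).hom) ≫ e := by
    simp only [Category.assoc, ← leftUnitor_naturality, leftUnitor_inv_naturality_assoc,
      whisker_exchange_assoc]
  have h1 := ConcreteCategory.congr_hom h (1 : R)
  have h2 : e (1 : R) = m := one_smul R m
  rw [ConcreteCategory.comp_apply, h2] at h1
  exact h1

/-- The two unitors agree on the unit object, so naturality of the right unitor applies. -/
theorem ModuleCat.leftUnitor_inv_whiskerRight_leftUnitor_hom
    (f : 𝟙_ (ModuleCat.{u} R) ⟶ 𝟙_ (ModuleCat.{u} R)) :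
    (λ_ (𝟙_ (ModuleCat.{u} R))).inv ≫ f ▷ 𝟙_ (ModuleCat.{u} R) ≫ (λ_ _).hom = f := by
  rw [Iso.inv_comp_eq, unitors_equal, rightUnitor_naturality]

/-- Every endomorphism of the unit of a monoidal structure on modules is a scalar. -/
theorem ModuleCat.exists_tensorUnit_endomorphism_eq_smul
    (f : 𝟙_ (ModuleCat.{u} R) →ₗ[R] 𝟙_ (ModuleCat.{u} R)) : ∃ r : R, ∀ m, f m = r • m := by
  obtain ⟨r, hr⟩ := ModuleCat.exists_whiskerRight_eq_smul (ModuleCat.ofHom f)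
  exact ⟨r, fun m ↦ (ConcreteCategory.congr_hom
    (ModuleCat.leftUnitor_inv_whiskerRight_leftUnitor_hom (ModuleCat.ofHom f)) m).symm.trans
    (hr _ m)⟩

/-- Over a reduced ring, the annihilator of the unit is a radical ideal. -/
theorem ModuleCat.isRadical_annihilator_tensorUnit [IsReduced R]
    [MonoidalPreadditive (ModuleCat.{u} R)] :
    (Module.annihilator R (𝟙_ (ModuleCat.{u} R))).IsRadical := by
  rw [Ideal.isRadical_iff_pow_one_lt 2 one_lt_two]
  intro x hx
  let K := 𝟙_ (ModuleCat.{u} R)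
  let A := ModuleCat.of R R
  let f : K ⟶ K := ModuleCat.ofHom (LinearMap.lsmul R K x)
  have hff : f ≫ f = 0 := by
    ext k
    change x • x • k = 0
    rw [smul_smul, ← sq]
    exact Module.mem_annihilator.mp hx k
  -- The square-zero map f acts on R as r, so r² = 0 and reducedness of R gives r = 0.
  obtain ⟨r, hr⟩ := ModuleCat.exists_whiskerRight_eq_smul f
  have hr2 : r * r = 0 := by
    have h : ((λ_ A).inv ≫ f ▷ A ≫ (λ_ A).hom) ≫ (λ_ A).inv ≫ f ▷ A ≫ (λ_ A).hom = 0 := by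
      simp only [Category.assoc, Iso.hom_inv_id_assoc, ← comp_whiskerRight_assoc, hff,
        MonoidalPreadditive.zero_whiskerRight, Limits.zero_comp, Limits.comp_zero]
    have h1 := ConcreteCategory.congr_hom h (1 : R)
    rw [ConcreteCategory.comp_apply, hr, hr, smul_smul] at h1
    exact (mul_one _).symm.trans h1
  have hr0 : r = 0 := IsReduced.eq_zero r ⟨2, (sq r).trans hr2⟩
  rw [Module.mem_annihilator]
  intro k
  have := hr K k
  rw [ModuleCat.leftUnitor_inv_whiskerRight_leftUnitor_hom, hr0, zero_smul] at this
  exact this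

end MonoidalModuleCat

theorem corollary4p6 {R : Type u} [CommRing R] [IsNoetherianRing R] [IsReduced R]
    (S : AdditiveClosedSymmetricMonoidalStructure (ModuleCat.{u} R)) :
    ∃ 𝔞 𝔟 : Ideal R, 𝔟.IsRadical ∧ 𝔟 ≤ 𝔞 ∧ 𝔟.colon (𝔞 : Set R) = 𝔟 ∧
      Nonempty (S.unit ≃ₗ[R] (𝔞 ⧸ 𝔟.submoduleOf 𝔞)) := by
  let _ := S.monoidal
  let _ := S.symmetric
  let _ := S.closed
  have _ := S.additive
  have hfin : Module.Finite R S.unit := ModuleCat.finite_tensorUnit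
  have hrad : (Module.annihilator R S.unit).IsRadical :=
    ModuleCat.isRadical_annihilator_tensorUnit
  obtain ⟨𝔞, hle, hcolon, he⟩ :=
    Module.exists_ideal_quotient_equiv_of_endomorphisms_scalar (M := S.unit) rfl hrad
      ModuleCat.exists_tensorUnit_endomorphism_eq_smul
  exact ⟨𝔞, _, hrad, hle, hcolon, he⟩
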